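/- A function $q:\mathbb R^n\to\mathbb R$ is called quadratic if $q(x)=\tfrac12 x^{\mathsf T}Ax+b^{\mathsf T}x+c$ with $A=A^{\mathsf T}\in\mathbb R^{n\times n}$, $b\in\mathbb R^n$, $c\in\mathbb R$. A convex set $F_0\subset\mathbb R^n$ is called a quasi-Frank-and-Wolfe set (qFW-set) if every quadratic function $q$ which is bounded below on $F_0$ and quasi-convex on $F_0$ (that is, $\{x\in F_0: q(x)\le\alpha\}$ is convex for every $\alpha\in\mathbb R$) attains its infimum on $F_0$. Let $F_0\subset\mathbb R^n$ be a qFW-set, and let $f_1,\dots,f_m$ be real polynomials in $n$ variables which are convex on $F_0$, such that the set $$F=\{x\in F_0 : f_i(x)\le 0,\ i=1,\dots,m\}$$ is nonempty. Let $f$ be a real polynomial in $n$ variables which is bounded below on $F$ and has at least one nonempty convex sub-level set on $F$, i.e. for some $\alpha\in\mathbb R$ the set $\{x\in F: f(x)\le\alpha\}$ is nonempty and convex. Then $f$ attains its infimum on $F$, i.e. there is $\bar x\in F$ with $f(\bar x)\le f(x)$ for all $x\in F$. -/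

import Mathlib

/-- A quadratic function on `ℝⁿ`: `x ↦ ½ xᵀ A x + bᵀ x + c` with `A` symmetric. -/
def IsQuadratic {n : ℕ} (q : EuclideanSpace ℝ (Fin n) → ℝ) : Prop :=
  ∃ (A : Matrix (Fin n) (Fin n) ℝ) (b : EuclideanSpace ℝ (Fin n)) (c : ℝ), A.IsSymm ∧
    ∀ x, q x = 1 / 2 * (∑ i, ∑ j, x i * A i j * x j) + (∑ i, b i * x i) + c

/-- `f` attains its infimum on `F`: there is a minimizer of `f` over `F` in `F`. -/
def AttainsInfOn {E : Type*} (f : E → ℝ) (F : Set E) : Prop :=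
  ∃ x ∈ F, ∀ y ∈ F, f x ≤ f y

/-- A quasi-Frank-and-Wolfe set: a convex set on which every quadratic function that is
quasi-convex and bounded below on the set attains its infimum. -/
def IsQFW {n : ℕ} (F : Set (EuclideanSpace ℝ (Fin n))) : Prop :=
  Convex ℝ F ∧ ∀ q : EuclideanSpace ℝ (Fin n) → ℝ, IsQuadratic q →
    QuasiconvexOn ℝ F q → BddBelow (q '' F) → AttainsInfOn q F

/-- The function on `ℝⁿ` defined by a real polynomial in `n` variables. -/
noncomputable def polyFun {n : ℕ} (p : MvPolynomial (Fin n) ℝ) :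
    EuclideanSpace ℝ (Fin n) → ℝ :=
  fun x => MvPolynomial.eval (fun i => x i) p

open Filter Topology Set

/-! The quasi-Frank-and-Wolfe property is used only to show that linear images of `F₀` are closed.
Closedness of images survives projections and affine slices, and being polynomial on lines survives
restriction to subspaces, so one can induct on dimension without coordinates.

It suffices to minimise over the convex sublevel set `C`. If `C` is bounded, it is compact; if its
affine hull is proper, restrict to the hull. Otherwise `C` has interior and a recession direction
`d`. Along `d`, `f` is a polynomial bounded on half-lines, hence constant. A constraint is either
invariant along `d` or eventually nonpositive on every `d`-ray from the ambient set, so it can be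
dropped. Projecting along `d` lowers the dimension. -/

/-- A continuous function whose restriction to every line is a polynomial in the parameter. -/
def PolyOnLines {E : Type*} [NormedAddCommGroup E] [NormedSpace ℝ E] (f : E → ℝ) : Prop :=
  Continuous f ∧ ∀ x d : E, ∃ P : Polynomial ℝ, ∀ t : ℝ, f (x + t • d) = P.eval t

/-- All linear images of `S` in finite-dimensional spaces are closed. -/
def HasClosedLinearImages {E : Type} [NormedAddCommGroup E] [NormedSpace ℝ E] (S : Set E) : Prop :=
  ∀ (G : Type) [NormedAddCommGroup G] [NormedSpace ℝ G] [FiniteDimensional ℝ G]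
    (L : E →ₗ[ℝ] G), IsClosed (L '' S)

section PolyOnLines

variable {E G : Type*} [NormedAddCommGroup E] [NormedSpace ℝ E]
  [NormedAddCommGroup G] [NormedSpace ℝ G]

theorem PolyOnLines.comp_affine [FiniteDimensional ℝ G] {f : E → ℝ} (hf : PolyOnLines f)
    (x₀ : E) (L : G →ₗ[ℝ] E) : PolyOnLines fun y => f (x₀ + L y) := by
  refine ⟨hf.1.comp (continuous_const.add L.continuous_of_finiteDimensional), fun x d => ?_⟩
  obtain ⟨P, hP⟩ := hf.2 (x₀ + L x) (L d)
  exact ⟨P, fun t => by simp only [← hP t, map_add, map_smul, add_assoc]⟩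

theorem PolyOnLines.comp_linear [FiniteDimensional ℝ G] {f : E → ℝ} (hf : PolyOnLines f)
    (L : G →ₗ[ℝ] E) : PolyOnLines fun y => f (L y) := by
  simpa using hf.comp_affine 0 L

theorem PolyOnLines.zero : PolyOnLines fun _ : E => (0 : ℝ) :=
  ⟨continuous_const, fun _ _ => ⟨0, fun _ => by simp⟩⟩

theorem PolyOnLines.translate_sub {f : E → ℝ} (hf : PolyOnLines f) (v : E) :
    PolyOnLines fun x => f (x + v) - f x := by
  refine ⟨(hf.1.comp (continuous_id.add continuous_const)).sub hf.1, fun x d => ?_⟩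
  obtain ⟨P, hP⟩ := hf.2 (x + v) d
  obtain ⟨Q, hQ⟩ := hf.2 x d
  exact ⟨P - Q, fun t => by rw [Polynomial.eval_sub, ← hP, ← hQ, add_right_comm]⟩

/-- A function polynomial on lines that vanishes on a set with interior vanishes identically. -/
theorem PolyOnLines.eq_zero {f : E → ℝ} (hf : PolyOnLines f) {C : Set E}
    (hC : (interior C).Nonempty) (h : ∀ x ∈ C, f x = 0) (x : E) : f x = 0 := by
  obtain ⟨y, hy⟩ := hC
  obtain ⟨P, hP⟩ := hf.2 y (x - y)
  have hcont : Tendsto (fun t : ℝ => y + t • (x - y)) (𝓝 0) (𝓝 y) := by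
    have : Continuous fun t : ℝ => y + t • (x - y) := by fun_prop
    simpa using this.tendsto 0
  have hev : ∀ᶠ t in 𝓝 (0 : ℝ), P.eval t = 0 := by
    filter_upwards [hcont (mem_interior_iff_mem_nhds.1 hy)] with t ht
    rw [← hP, h _ ht]
  have hP0 : P = 0 := Polynomial.eq_zero_of_infinite_isRoot P
    (infinite_of_mem_nhds 0 hev)
  simpa [hP0] using hP 1

theorem polyFun_polyOnLines {n : ℕ} (p : MvPolynomial (Fin n) ℝ) : PolyOnLines (polyFun p) := by
  refine ⟨?_, fun x d => ⟨MvPolynomial.aeval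
    (fun i => Polynomial.C (x i) + Polynomial.X * Polynomial.C (d i)) p, fun t => ?_⟩⟩
  · unfold polyFun
    exact (MvPolynomial.continuous_eval p).comp (by fun_prop)
  · unfold polyFun
    induction p using MvPolynomial.induction_on with
    | C a => simp
    | add p q hp hq => rw [map_add, map_add, Polynomial.eval_add, hp, hq]
    | mul_X p i hp =>
      rw [map_mul, map_mul, Polynomial.eval_mul, hp]
      simp [mul_comm t]

end PolyOnLines

section Univariate

open Polynomial

/-- A polynomial bounded on a half-line is constant. -/
theorem Polynomial.eval_eq_of_bounded {P : ℝ[X]} {a b : ℝ}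
    (h : ∀ t, 0 ≤ t → a ≤ P.eval t ∧ P.eval t ≤ b) (t : ℝ) : P.eval t = P.eval 0 := by
  have hd : P.degree ≤ 0 := by
    rw [← Polynomial.isBoundedUnder_abs_atTop_iff]
    refine ⟨max |a| |b|, eventually_map.2 ?_⟩
    filter_upwards [eventually_ge_atTop 0] with t ht
    exact abs_le_max_abs_abs (h t ht).1 (h t ht).2
  rw [Polynomial.eq_C_of_degree_le_zero hd]
  simp

/-- A nonconstant polynomial bounded above on a half-line decreases at least linearly. -/
theorem Polynomial.eventually_eval_le_of_bddAbove {P : ℝ[X]} {b : ℝ}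
    (h : ∀ t, 0 ≤ t → P.eval t ≤ b) (hne : ∃ t, P.eval t ≠ P.eval 0) :
    ∃ s > 0, ∀ᶠ t in atTop, P.eval t ≤ P.eval 0 - s * t := by
  have hP (t : ℝ) : P.eval t = t * P.divX.eval t + P.eval 0 := by
    conv_lhs => rw [← Polynomial.divX_mul_X_add P]
    simp [Polynomial.coeff_zero_eq_eval_zero, mul_comm]
  -- The quotient cannot stay above a positive constant, since `P` would then grow linearly.
  have key : ∀ c > 0, ¬ ∀ᶠ t in atTop, c ≤ P.divX.eval t := by
    intro c hc hev
    obtain ⟨t, h1, h2, h3⟩ := (hev.and ((eventually_ge_atTop 0).and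
      (eventually_gt_atTop ((b - P.eval 0) / c)))).exists
    have := h t h2
    rw [hP t] at this
    rw [div_lt_iff₀ hc] at h3
    nlinarith [mul_le_mul_of_nonneg_left h1 h2]
  suffices ∃ s > 0, ∀ᶠ t in atTop, P.divX.eval t ≤ -s by
    obtain ⟨s, hs, hev⟩ := this
    refine ⟨s, hs, ?_⟩
    filter_upwards [hev, eventually_ge_atTop 0] with t h1 h2
    rw [hP t]
    nlinarith [mul_le_mul_of_nonneg_left h1 h2]
  rcases le_or_gt P.divX.degree 0 with hd | hd
  · have hc := Polynomial.eq_C_of_degree_le_zero hd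
    set c := P.divX.coeff 0
    rcases lt_trichotomy c 0 with h0 | h0 | h0
    · exact ⟨-c, by linarith, Eventually.of_forall fun t => by simp [hc]⟩
    · obtain ⟨t, ht⟩ := hne
      rw [hP t, hc, h0] at ht
      simp at ht
    · exact absurd (Eventually.of_forall fun t => by simp [hc]) (key c h0)
  · rcases le_total 0 P.divX.leadingCoeff with h0 | h0
    · exact absurd ((Polynomial.tendsto_atTop_of_leadingCoeff_nonneg _ hd h0).eventually_ge_atTop 1)
        (key 1 one_pos)
    · exact ⟨1, one_pos,
        (Polynomial.tendsto_atBot_of_leadingCoeff_nonpos _ hd h0).eventually_le_atBot _⟩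

end Univariate

section ClosedImages

variable {E : Type} [NormedAddCommGroup E] [NormedSpace ℝ E] {S : Set E}

theorem HasClosedLinearImages.isClosed [FiniteDimensional ℝ E] (hS : HasClosedLinearImages S) : IsClosed S := by
  simpa using hS E LinearMap.id

theorem HasClosedLinearImages.image (hS : HasClosedLinearImages S) {G : Type}
    [NormedAddCommGroup G] [NormedSpace ℝ G] (L : E →ₗ[ℝ] G) :
    HasClosedLinearImages (L '' S) := by
  intro H _ _ _ M
  simpa [image_image] using hS H (M ∘ₗ L)

/-- Slicing by an affine subspace preserves closedness of linear images. -/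
theorem HasClosedLinearImages.slice [FiniteDimensional ℝ E] (hS : HasClosedLinearImages S) (V : Submodule ℝ E) (x₀ : E) :
    HasClosedLinearImages {v : V | x₀ + (v : E) ∈ S} := by
  intro G _ _ _ L
  obtain ⟨L', hL'⟩ := LinearMap.exists_extend L
  obtain ⟨W, hW⟩ := V.exists_isCompl
  -- The kernel of `M` is `V`, so the value `M x₀` singles out the coset `x₀ + V`; the image of the
  -- slice is thus a section of a closed image.
  let M := W.projectionOnto V hW.symm
  have hcl := hS (G × W) (L'.prod M)
  have : L '' {v : V | x₀ + (v : E) ∈ S} =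
      (fun y => (y + L' x₀, M x₀)) ⁻¹' (L'.prod M '' S) := by
    ext y
    constructor
    · rintro ⟨v, hv, rfl⟩
      refine ⟨_, hv, Prod.ext (?_ : L' _ = _) (?_ : M _ = _)⟩
      · rw [map_add, add_comm, ← hL']; rfl
      · rw [map_add, (Submodule.projectionOnto_apply_eq_zero_iff hW.symm).2 v.2, add_zero]
    · rintro ⟨z, hz, hzy⟩
      have h1 : L' z = y + L' x₀ := congrArg Prod.fst hzy
      have h2 : M z = M x₀ := congrArg Prod.snd hzy
      have hzV : z - x₀ ∈ V := by
        rw [← Submodule.projectionOnto_apply_eq_zero_iff hW.symm, map_sub]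
        exact sub_eq_zero.2 h2
      refine ⟨⟨z - x₀, hzV⟩, by simpa using hz, ?_⟩
      have : L ⟨z - x₀, hzV⟩ = L' (z - x₀) := by rw [← hL']; rfl
      rw [this, map_sub, h1, add_sub_cancel_right]
  rw [this]
  exact hcl.preimage (by fun_prop)

end ClosedImages

section Quadratic

variable {n : ℕ}

theorem IsQuadratic.add {q r : EuclideanSpace ℝ (Fin n) → ℝ} (hq : IsQuadratic q)
    (hr : IsQuadratic r) : IsQuadratic fun x => q x + r x := by
  obtain ⟨A, b, c, hA, h⟩ := hq
  obtain ⟨A', b', c', hA', h'⟩ := hr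
  refine ⟨A + A', b + b', c + c', hA.add hA', fun x => ?_⟩
  simp only [h, h', Matrix.add_apply, PiLp.add_apply, mul_add, add_mul, Finset.sum_add_distrib]
  ring

theorem IsQuadratic.zero : IsQuadratic fun _ : EuclideanSpace ℝ (Fin n) => (0 : ℝ) :=
  ⟨0, 0, 0, Matrix.isSymm_zero, fun x => by simp⟩

theorem IsQuadratic.sum {ι : Type*} (s : Finset ι) {q : ι → EuclideanSpace ℝ (Fin n) → ℝ}
    (hq : ∀ i ∈ s, IsQuadratic (q i)) : IsQuadratic fun x => ∑ i ∈ s, q i x := by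
  classical
  induction s using Finset.induction_on with
  | empty => simpa using IsQuadratic.zero
  | insert a s ha ih =>
    simp only [Finset.sum_insert ha]
    exact (hq a (by simp)).add (ih fun i hi => hq i (by simp [hi]))

theorem IsQuadratic.linear_sub_sq (ℓ : EuclideanSpace ℝ (Fin n) →ₗ[ℝ] ℝ) (c : ℝ) :
    IsQuadratic fun x => (ℓ x - c) ^ 2 := by
  let a : Fin n → ℝ := fun i => ℓ (EuclideanSpace.single i 1)
  have hℓ (x : EuclideanSpace ℝ (Fin n)) : ℓ x = ∑ i, a i * x i := by
    conv_lhs => rw [← (EuclideanSpace.basisFun (Fin n) ℝ).sum_repr x]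
    simp [a, mul_comm]
  refine ⟨Matrix.of fun i j => 2 * a i * a j, WithLp.toLp 2 fun i => -2 * c * a i, c ^ 2, ?_,
    fun x => ?_⟩
  · ext i j
    simp only [Matrix.transpose_apply, Matrix.of_apply]
    ring
  · have h1 : ∑ i, ∑ j, x i * (2 * a i * a j) * x j = 2 * (ℓ x * ℓ x) := by
      rw [hℓ, Finset.sum_mul_sum, Finset.mul_sum]
      refine Finset.sum_congr rfl fun i _ => ?_
      rw [Finset.mul_sum]
      exact Finset.sum_congr rfl fun j _ => by ring
    have h2 : ∑ i, -2 * c * a i * x i = -2 * c * ℓ x := by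
      rw [hℓ, Finset.mul_sum]
      exact Finset.sum_congr rfl fun i _ => by ring
    simp only [Matrix.of_apply]
    rw [h1, h2]
    ring

theorem convexOn_linear_sub_sq {E : Type*} [AddCommGroup E] [Module ℝ E] (ℓ : E →ₗ[ℝ] ℝ) (c : ℝ) :
    ConvexOn ℝ univ fun x => (ℓ x - c) ^ 2 := by
  have h : ConvexOn ℝ univ fun s : ℝ => (s - c) ^ 2 := by
    have := (even_two.convexOn_pow (𝕜 := ℝ)).translate_right (-c)
    simpa [Function.comp_def, neg_add_eq_sub] using this
  exact h.comp_linearMap ℓ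

theorem convexOn_finsetSum {E ι : Type*} [AddCommGroup E] [Module ℝ E] {S : Set E} (s : Finset ι)
    (hS : Convex ℝ S) {f : ι → E → ℝ} (hf : ∀ i ∈ s, ConvexOn ℝ S (f i)) :
    ConvexOn ℝ S fun x => ∑ i ∈ s, f i x := by
  classical
  induction s using Finset.induction_on with
  | empty => simpa using convexOn_const 0 hS
  | insert a s ha ih =>
    simp only [Finset.sum_insert ha]
    exact (hf a (by simp)).add (ih fun i hi => hf i (by simp [hi]))

/-- For `y` in the closure of the image, the sum of squared coordinates of `L x - y` is a convex
quadratic in `x` with infimum 0; attaining it puts `y` in the image. -/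
theorem IsQFW.hasClosedLinearImages {S : Set (EuclideanSpace ℝ (Fin n))} (hS : IsQFW S) :
    HasClosedLinearImages S := by
  intro G _ _ _ L
  refine isClosed_of_closure_subset fun y hy => ?_
  let b := Module.finBasis ℝ G
  let g : G → ℝ := fun z => ∑ j, (b.coord j z - b.coord j y) ^ 2
  have hg : Continuous g := continuous_finsetSum _ fun j _ =>
    (((b.coord j).continuous_of_finiteDimensional).sub continuous_const).pow 2
  have hg0 (z : G) : 0 ≤ g z := Finset.sum_nonneg fun j _ => sq_nonneg _
  have hquad : IsQuadratic fun x => g (L x) :=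
    IsQuadratic.sum _ fun j _ => IsQuadratic.linear_sub_sq (b.coord j ∘ₗ L) _
  have hconv : ConvexOn ℝ S fun x => g (L x) := by
    refine ConvexOn.subset (t := univ) ?_ (subset_univ _) hS.1
    exact convexOn_finsetSum Finset.univ convex_univ
      fun j _ => convexOn_linear_sub_sq (b.coord j ∘ₗ L) (b.coord j y)
  obtain ⟨x, hx, hmin⟩ := hS.2 _ hquad hconv.quasiconvexOn
    ⟨0, by rintro _ ⟨x, -, rfl⟩; exact hg0 _⟩
  have hle : ∀ z ∈ closure (L '' S), g (L x) ≤ g z := by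
    intro z hz
    refine closure_minimal ?_ (isClosed_le continuous_const hg) hz
    rintro _ ⟨w, hw, rfl⟩
    exact hmin w hw
  have h0 : g (L x) = 0 := le_antisymm ((hle y hy).trans_eq (by simp [g])) (hg0 _)
  refine ⟨x, hx, b.ext_elem fun j => ?_⟩
  have := (Finset.sum_eq_zero_iff_of_nonneg fun j _ => sq_nonneg _).1 h0 j (Finset.mem_univ j)
  simpa [sub_eq_zero] using this

end Quadratic

/-! ### Convex functions along recession directions -/

section Recession

variable {E : Type*} [NormedAddCommGroup E] [NormedSpace ℝ E]

/-- If a convex function polynomial on lines is bounded above and nonconstant along one ray of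
direction `d`, then it is eventually nonpositive along every ray of direction `d`. -/
theorem PolyOnLines.eventually_nonpos {p : E → ℝ} {S : Set E} {x₀ x d : E} {b : ℝ}
    (hp : PolyOnLines p) (hc : ConvexOn ℝ S p) (hray₀ : ∀ t : ℝ, 0 ≤ t → x₀ + t • d ∈ S)
    (hx : x ∈ S) (hb : ∀ t : ℝ, 0 ≤ t → p (x₀ + t • d) ≤ b)
    (hne : ∃ t : ℝ, p (x₀ + t • d) ≠ p x₀) :
    ∀ᶠ t : ℝ in atTop, p (x + t • d) ≤ 0 := by
  obtain ⟨P, hP⟩ := hp.2 x₀ d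
  have hP0 : P.eval 0 = p x₀ := by rw [← hP]; simp
  obtain ⟨s, hs, hev⟩ := Polynomial.eventually_eval_le_of_bddAbove (P := P) (b := b)
    (fun t ht => by rw [← hP]; exact hb t ht)
    (by obtain ⟨t, ht⟩ := hne; exact ⟨t, by rwa [← hP, hP0]⟩)
  -- Mix `x` with the far point `x₀ + (t / l) • d` at weight `l`: as `l → 0` the base point tends to
  -- `x`, while the decrease `s * t` persists.
  have main : ∀ t : ℝ, 0 < t → p (x + t • d) ≤ p x - s * t := by
    intro t ht
    have hlim : Tendsto (fun l : ℝ => p ((1 - l) • x + l • x₀ + t • d)) (𝓝[>] 0)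
        (𝓝 (p (x + t • d))) := by
      have : Continuous fun l : ℝ => p ((1 - l) • x + l • x₀ + t • d) :=
        hp.1.comp (by fun_prop)
      simpa using (this.tendsto 0).mono_left nhdsWithin_le_nhds
    have hlim' : Tendsto (fun l : ℝ => (1 - l) * p x + l * p x₀ - s * t) (𝓝[>] 0)
        (𝓝 (p x - s * t)) := by
      have : Continuous fun l : ℝ => (1 - l) * p x + l * p x₀ - s * t := by fun_prop
      simpa using (this.tendsto 0).mono_left nhdsWithin_le_nhds
    refine le_of_tendsto_of_tendsto hlim hlim' ?_
    have hdiv : Tendsto (fun l : ℝ => t / l) (𝓝[>] 0) atTop :=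
      tendsto_inv_nhdsGT_zero.const_mul_atTop ht
    filter_upwards [hdiv.eventually hev, self_mem_nhdsWithin,
      nhdsWithin_le_nhds (Iio_mem_nhds one_pos)] with l hl hl0 hl1
    have hl0 : 0 < l := hl0
    have hl1 : l < 1 := hl1
    rw [← hP, hP0] at hl
    have h := hc.2 hx (hray₀ (t / l) (by positivity)) (by linarith : 0 ≤ 1 - l) hl0.le (by ring)
    have e : (1 - l) • x + l • (x₀ + (t / l) • d) = (1 - l) • x + l • x₀ + t • d := by
      rw [smul_add, smul_smul, mul_div_cancel₀ _ hl0.ne', add_assoc]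
    rw [e, smul_eq_mul, smul_eq_mul] at h
    have h' := mul_le_mul_of_nonneg_left hl hl0.le
    have e' : l * (p x₀ - s * (t / l)) = l * p x₀ - s * t := by field_simp
    linarith
  filter_upwards [eventually_gt_atTop 0, eventually_ge_atTop (p x / s)] with t ht ht'
  rw [div_le_iff₀ hs] at ht'
  linarith [main t ht]

end Recession

/-! ### Induction on dimension -/

/-- A function polynomial on lines, bounded below on a nonempty convex set cut out of a convex set
with closed linear images by its own sublevel set and by convex inequalities that are polynomial
on lines, attains its minimum there. -/
theorem attainsInfOn_sublevel (N : ℕ) : ∀ (E : Type) [NormedAddCommGroup E] [NormedSpace ℝ E]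
    [FiniteDimensional ℝ E], Module.finrank ℝ E = N →
    ∀ (S : Set E), Convex ℝ S → HasClosedLinearImages S →
    ∀ {ι : Type} [Finite ι] (p : ι → E → ℝ), (∀ i, ConvexOn ℝ S (p i)) →
    (∀ i, PolyOnLines (p i)) → ∀ (f : E → ℝ), PolyOnLines f → ∀ (α : ℝ) (C : Set E),
    C = {x | x ∈ S ∧ (∀ i, p i x ≤ 0) ∧ f x ≤ α} → C.Nonempty → Convex ℝ C →
    BddBelow (f '' C) → AttainsInfOn f C := by
  induction N using Nat.strong_induction_on with
  | _ N ih =>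
  intro E _ _ _ hN S hSc hS ι _ p hpc hp f hf α C hC hne hCc hbdd
  have hCcl : IsClosed C := by
    have : C = S ∩ ((⋂ i, {x | p i x ≤ 0}) ∩ {x | f x ≤ α}) := by
      rw [hC]; ext x; simp only [mem_inter_iff, mem_iInter, mem_ofPred_eq]
    rw [this]
    exact hS.isClosed.inter ((isClosed_iInter fun i => isClosed_le (hp i).1 continuous_const).inter
      (isClosed_le hf.1 continuous_const))
  by_cases hb : Bornology.IsBounded C
  · exact (Metric.isCompact_of_isClosed_isBounded hCcl hb).exists_isMinOn hne hf.1.continuousOn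
  by_cases hspan : affineSpan ℝ C = ⊤
  · have hint : (interior C).Nonempty := hCc.interior_nonempty_iff_affineSpan_eq_top.2 hspan
    obtain ⟨d, hd0, hd⟩ := not_bounded_iff_exists_ne_zero_mem_asymptoticCone.1 hb
    have hCS : C ⊆ S := by rw [hC]; exact fun x hx => hx.1
    have hrayC : ∀ x ∈ C, ∀ t : ℝ, 0 ≤ t → x + t • d ∈ C := fun x hx t ht => by
      simpa [add_comm] using
        hCc.smul_vadd_mem_of_isClosed_of_mem_asymptoticCone hCcl ht hd hx
    have hrayS : ∀ x ∈ S, ∀ t : ℝ, 0 ≤ t → x + t • d ∈ S := fun x hx t ht => by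
      simpa [add_comm] using hSc.smul_vadd_mem_of_isClosed_of_mem_asymptoticCone hS.isClosed ht
        (asymptoticCone_mono hCS hd) hx
    have hinv (g : E → ℝ) (hg : PolyOnLines g) (h : ∀ x ∈ C, ∀ t : ℝ, g (x + t • d) = g x)
        (x : E) (t : ℝ) : g (x + t • d) = g x :=
      sub_eq_zero.1 ((hg.translate_sub (t • d)).eq_zero hint
        (fun y hy => sub_eq_zero.2 (h y hy t)) x)
    have hfd : ∀ (x : E) (t : ℝ), f (x + t • d) = f x := by
      obtain ⟨m, hm⟩ := hbdd
      refine hinv f hf fun x hx t => ?_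
      obtain ⟨P, hP⟩ := hf.2 x d
      have := Polynomial.eval_eq_of_bounded (P := P) (a := m) (b := α) (fun t ht => by
        have hmem := hrayC x hx t ht
        rw [← hP]
        refine ⟨hm (mem_image_of_mem f hmem), ?_⟩
        rw [hC] at hmem
        exact hmem.2.2) t
      rw [← hP, ← hP] at this
      simpa using this
    have hpd (i : ι) : (∀ (x : E) (t : ℝ), p i (x + t • d) = p i x) ∨
        ∀ x ∈ S, ∀ᶠ t : ℝ in atTop, p i (x + t • d) ≤ 0 := by
      by_cases h : ∀ x ∈ C, ∀ t : ℝ, p i (x + t • d) = p i x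
      · exact Or.inl (hinv (p i) (hp i) h)
      · push Not at h
        obtain ⟨x₀, hx₀, hne⟩ := h
        refine Or.inr fun x hx => (hp i).eventually_nonpos (hpc i)
          (hrayS x₀ (hCS hx₀)) hx (b := 0) (fun t ht => ?_) hne
        have := hrayC x₀ hx₀ t ht
        rw [hC] at this
        exact this.2.1 i
    obtain ⟨φ, hφ⟩ := SeparatingDual.exists_eq_one (R := ℝ) hd0
    -- The hyperplane `V` models the quotient of `E` by the line of `d`, with `π` the projection
    -- along `d`.
    let V : Submodule ℝ E := LinearMap.ker (φ : E →ₗ[ℝ] ℝ)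
    let π : E →ₗ[ℝ] V := LinearMap.codRestrict V
      (LinearMap.id - (φ : E →ₗ[ℝ] ℝ).smulRight d) (fun x => by simp [V, hφ])
    have hπ (x : E) : ((π x : V) : E) = x + (-φ x) • d := by
      simp [π, sub_eq_add_neg]
    have hπd (x : E) (t : ℝ) : π (x + t • d) = π x := by
      apply Subtype.ext
      rw [hπ, hπ]
      simp only [map_add, map_smul, hφ, smul_eq_mul, mul_one]
      module
    have hlt : Module.finrank ℝ V < N := by
      rw [← hN]
      refine Submodule.finrank_lt fun h => ?_
      have : d ∈ V := h ▸ Submodule.mem_top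
      simp [V, hφ] at this
    classical
    -- Non-invariant constraints become 0, which is always feasible.
    let p' : ι → V → ℝ := fun i =>
      if ∀ (x : E) (t : ℝ), p i (x + t • d) = p i x then fun v => p i v else fun _ => 0
    have hp'1 (i : ι) (h : ∀ (x : E) (t : ℝ), p i (x + t • d) = p i x) (v : V) :
        p' i v = p i v := by simp only [p', if_pos h]
    have hp'2 (i : ι) (h : ¬ ∀ (x : E) (t : ℝ), p i (x + t • d) = p i x) :
        p' i = fun _ => 0 := by simp only [p', if_neg h]
    have hp'π (i : ι) (h : ∀ (x : E) (t : ℝ), p i (x + t • d) = p i x) (x : E) :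
        p' i (π x) = p i x := by rw [hp'1 i h, hπ, h]
    have hfπ (x : E) : f (π x) = f x := by rw [hπ, hfd]
    have hCπ : π '' C = {v | v ∈ π '' S ∧ (∀ i, p' i v ≤ 0) ∧ f v ≤ α} := by
      ext v
      constructor
      · rintro ⟨x, hx, rfl⟩
        rw [hC] at hx
        refine ⟨⟨x, hx.1, rfl⟩, fun i => ?_, by rw [hfπ]; exact hx.2.2⟩
        by_cases h : ∀ (x : E) (t : ℝ), p i (x + t • d) = p i x
        · rw [hp'π i h]; exact hx.2.1 i
        · rw [hp'2 i h]
      · rintro ⟨⟨x, hx, rfl⟩, h1, h2⟩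
        -- As `ι` is finite, one shift along `d` meets all constraints at once, lifting `v` to a
        -- point of `C`.
        have hev : ∀ᶠ t : ℝ in atTop, ∀ i, p i (x + t • d) ≤ 0 := by
          refine eventually_all.2 fun i => ?_
          rcases em (∀ (x : E) (t : ℝ), p i (x + t • d) = p i x) with h | h
          · refine Eventually.of_forall fun t => ?_
            rw [h, ← hp'π i h]
            exact h1 i
          · exact (hpd i).resolve_left h x hx
        obtain ⟨t, ht, ht0⟩ := (hev.and (eventually_ge_atTop 0)).exists
        refine ⟨x + t • d, ?_, hπd x t⟩
        rw [hC]
        exact ⟨hrayS x hx t ht0, ht, by rw [hfd, ← hfπ]; exact h2⟩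
    have hp'c (i : ι) : ConvexOn ℝ (π '' S) (p' i) := by
      by_cases h : ∀ (x : E) (t : ℝ), p i (x + t • d) = p i x
      · refine ⟨hSc.linear_image π, ?_⟩
        rintro _ ⟨x, hx, rfl⟩ _ ⟨y, hy, rfl⟩ a b ha hb hab
        rw [← map_smul, ← map_smul, ← map_add, hp'π i h, hp'π i h, hp'π i h]
        exact (hpc i).2 hx hy ha hb hab
      · rw [hp'2 i h]
        exact convexOn_const 0 (hSc.linear_image π)
    have hp'p (i : ι) : PolyOnLines (p' i) := by
      by_cases h : ∀ (x : E) (t : ℝ), p i (x + t • d) = p i x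
      · have : p' i = fun v => p i (V.subtype v) := funext fun v => hp'1 i h v
        rw [this]
        exact (hp i).comp_linear V.subtype
      · rw [hp'2 i h]
        exact PolyOnLines.zero
    obtain ⟨_, ⟨x, hx, rfl⟩, hmin⟩ := ih _ hlt V rfl (π '' S) (hSc.linear_image π) (hS.image π)
      p' hp'c hp'p (fun v => f v) (hf.comp_linear V.subtype) α (π '' C) hCπ (hne.image π)
      (hCc.linear_image π) (by
        rw [image_image]
        simpa only [hfπ] using hbdd)
    refine ⟨x, hx, fun y hy => ?_⟩
    have := hmin (π y) (mem_image_of_mem π hy)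
    simpa only [hfπ] using this
  -- Proper affine hull: pass to its direction space, based at `x₀`.
  · obtain ⟨x₀, hx₀⟩ := hne
    let V : Submodule ℝ E := (affineSpan ℝ C).direction
    have hlt : Module.finrank ℝ V < N := by
      rw [← hN]
      refine Submodule.finrank_lt fun h => hspan ?_
      exact (AffineSubspace.direction_eq_top_iff_of_nonempty
        ⟨x₀, subset_affineSpan ℝ C hx₀⟩).1 h
    let e : V →ᵃ[ℝ] E := AffineMap.const ℝ V x₀ + V.subtype.toAffineMap
    have he (v : V) : e v = x₀ + (v : E) := rfl
    have hsurj : ∀ x ∈ C, ∃ v : V, e v = x := fun x hx =>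
      ⟨⟨x - x₀, AffineSubspace.vsub_mem_direction (subset_affineSpan ℝ C hx)
        (subset_affineSpan ℝ C hx₀)⟩, by simp [he]⟩
    obtain ⟨v₀, hv₀⟩ := hsurj x₀ hx₀
    obtain ⟨v, hv, hmin⟩ := ih _ hlt V rfl (e ⁻¹' S) (hSc.affine_preimage e) (hS.slice V x₀)
      (fun i => p i ∘ e) (fun i => (hpc i).comp_affineMap e)
      (fun i => (hp i).comp_affine x₀ V.subtype) (f ∘ e) (hf.comp_affine x₀ V.subtype) α
      (e ⁻¹' C) (by rw [hC]; rfl) ⟨v₀, by rw [mem_preimage, hv₀]; exact hx₀⟩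
      (hCc.affine_preimage e) (hbdd.mono (by
        rintro _ ⟨v, hv, rfl⟩
        exact ⟨e v, hv, rfl⟩))
    refine ⟨e v, hv, fun y hy => ?_⟩
    obtain ⟨w, rfl⟩ := hsurj y hy
    exact hmin w hy

theorem mainTheorem10 {n m : ℕ} (F₀ : Set (EuclideanSpace ℝ (Fin n))) (hF₀ : IsQFW F₀)
    (p : Fin m → MvPolynomial (Fin n) ℝ) (hp : ∀ i, ConvexOn ℝ F₀ (polyFun (p i)))
    (F : Set (EuclideanSpace ℝ (Fin n)))
    (hF : F = {x | x ∈ F₀ ∧ ∀ i, polyFun (p i) x ≤ 0}) (hne : F.Nonempty)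
    (f : MvPolynomial (Fin n) ℝ) (hbdd : BddBelow (polyFun f '' F))
    (hsub : ∃ α : ℝ, {x | x ∈ F ∧ polyFun f x ≤ α}.Nonempty ∧
      Convex ℝ {x | x ∈ F ∧ polyFun f x ≤ α}) :
    AttainsInfOn (polyFun f) F := by
  obtain ⟨α, hne', hconv⟩ := hsub
  have hC : {x | x ∈ F ∧ polyFun f x ≤ α} =
      {x | x ∈ F₀ ∧ (∀ i, polyFun (p i) x ≤ 0) ∧ polyFun f x ≤ α} := by
    rw [hF]
    ext x
    simp [and_assoc]
  obtain ⟨x, hx, hmin⟩ := attainsInfOn_sublevel _ _ rfl F₀ hF₀.1 hF₀.hasClosedLinearImages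
    (fun i => polyFun (p i)) hp (fun i => polyFun_polyOnLines (p i)) (polyFun f)
    (polyFun_polyOnLines f) α _ hC hne' hconv
    (hbdd.mono (image_mono fun x hx => hx.1))
  refine ⟨x, hx.1, fun y hy => ?_⟩
  rcases le_or_gt (polyFun f y) α with h | h
  · exact hmin y ⟨hy, h⟩
  · exact hx.2.trans h.le
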